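/- Let $p(x,y,z)=\sum_{i+j+k=4}p_{ijk}x^iy^jz^k$ be a ternary quartic, i.e. a homogeneous polynomial of degree 4 in three variables with real coefficients (the zero polynomial is allowed). Let $\mathrm{PSD}_6$ be the set of real symmetric positive semidefinite $6\times 6$ matrices, let $$A_0=\frac12\begin{bmatrix} 2p_{400}&p_{310}&p_{301}&0&p_{211}&0\\ p_{310}&2p_{220}&0&p_{130}&p_{121}&0\\ p_{301}&0&2p_{202}&0&p_{112}&p_{103}\\ 0&p_{130}&0&2p_{040}&p_{031}&0\\ p_{211}&p_{121}&p_{112}&p_{031}&2p_{022}&p_{013}\\ 0&0&p_{103}&0&p_{013}&2p_{004}\end{bmatrix},$$ and let $\mathcal W$ be the linear space of all symmetric matrices $$\begin{bmatrix} 0&0&0&w_1&w_2&w_3\\ 0&-2w_1&-w_2&0&w_4&w_5\\ 0&-w_2&-2w_3&-w_4&-w_5&0\\ w_1&0&-w_4&0&0&w_6\\ w_2&w_4&-w_5&0&-2w_6&0\\ w_3&w_5&0&w_6&0&0\end{bmatrix},\qquad w_1,\dots,w_6\in\mathbb R.$$ Then: 1. $p$ is a finite sum of squares of real quadratic forms in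 $x,y,z$ if and only if $(A_0+\mathcal W)\cap\mathrm{PSD}_6\neq\varnothing$. 2. If $p(x,y,z)\ge 0$ for all $(x,y,z)\in\mathbb R^3$, then $p$ is a finite sum of squares of real quadratic forms, and, equivalently, $(A_0+\mathcal W)\cap\mathrm{PSD}_6\neq\varnothing$. -/

import Mathlib

open scoped Pointwise

namespace TernaryQuartic

/-- The coefficient `p_{ijk}` of `x^i y^j z^k` in a real polynomial in three variables
(the variables `x, y, z` are numbered `0, 1, 2`). -/
noncomputable def pcoeff (p : MvPolynomial (Fin 3) ℝ) (i j k : ℕ) : ℝ :=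
  p.coeff (Finsupp.single 0 i + Finsupp.single 1 j + Finsupp.single 2 k)

/-- `p` is a finite sum of squares of quadratic forms (the zero form is allowed). -/
def IsSumOfSquaresOfQuadraticForms (p : MvPolynomial (Fin 3) ℝ) : Prop :=
  ∃ (k : ℕ) (q : Fin k → MvPolynomial (Fin 3) ℝ),
    (∀ i, (q i).IsHomogeneous 2) ∧ p = ∑ i, q i ^ 2

/-- The set of real symmetric positive semidefinite `n × n` matrices. -/
def PSD (n : ℕ) : Set (Matrix (Fin n) (Fin n) ℝ) :=
  {A | A.PosSemidef}

/-- The symmetric matrix `A₀` built from the coefficients of `p`. -/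
noncomputable def A₀ (p : MvPolynomial (Fin 3) ℝ) : Matrix (Fin 6) (Fin 6) ℝ :=
  (1 / 2 : ℝ) •
  !![2 * pcoeff p 4 0 0, pcoeff p 3 1 0, pcoeff p 3 0 1, 0, pcoeff p 2 1 1, 0;
     pcoeff p 3 1 0, 2 * pcoeff p 2 2 0, 0, pcoeff p 1 3 0, pcoeff p 1 2 1, 0;
     pcoeff p 3 0 1, 0, 2 * pcoeff p 2 0 2, 0, pcoeff p 1 1 2, pcoeff p 1 0 3;
     0, pcoeff p 1 3 0, 0, 2 * pcoeff p 0 4 0, pcoeff p 0 3 1, 0;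
     pcoeff p 2 1 1, pcoeff p 1 2 1, pcoeff p 1 1 2, pcoeff p 0 3 1, 2 * pcoeff p 0 2 2,
       pcoeff p 0 1 3;
     0, 0, pcoeff p 1 0 3, 0, pcoeff p 0 1 3, 2 * pcoeff p 0 0 4]

/-- The generic element of `W`, with parameters `w₁, …, w₆`. -/
def Wmat (w₁ w₂ w₃ w₄ w₅ w₆ : ℝ) : Matrix (Fin 6) (Fin 6) ℝ :=
  !![0, 0, 0, w₁, w₂, w₃;
     0, -2 * w₁, -w₂, 0, w₄, w₅;
     0, -w₂, -2 * w₃, -w₄, -w₅, 0;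
     w₁, 0, -w₄, 0, 0, w₆;
     w₂, w₄, -w₅, 0, -2 * w₆, 0;
     w₃, w₅, 0, w₆, 0, 0]

/-- The linear subspace `W` of the space of real symmetric `6 × 6` matrices. -/
def W : Submodule ℝ (Matrix (Fin 6) (Fin 6) ℝ) where
  carrier := {A | ∃ w₁ w₂ w₃ w₄ w₅ w₆ : ℝ, A = Wmat w₁ w₂ w₃ w₄ w₅ w₆}
  add_mem' := by
    rintro _ _ ⟨a₁, a₂, a₃, a₄, a₅, a₆, rfl⟩ ⟨b₁, b₂, b₃, b₄, b₅, b₆, rfl⟩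
    refine ⟨a₁ + b₁, a₂ + b₂, a₃ + b₃, a₄ + b₄, a₅ + b₅, a₆ + b₆, ?_⟩
    ext i j
    fin_cases i <;> fin_cases j <;> simp [Wmat] <;> ring
  zero_mem' := by
    refine ⟨0, 0, 0, 0, 0, 0, ?_⟩
    ext i j
    fin_cases i <;> fin_cases j <;> simp [Wmat]
  smul_mem' := by
    rintro c _ ⟨a₁, a₂, a₃, a₄, a₅, a₆, rfl⟩
    refine ⟨c * a₁, c * a₂, c * a₃, c * a₄, c * a₅, c * a₆, ?_⟩
    ext i j
    fin_cases i <;> fin_cases j <;> simp [Wmat] <;> ring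

end TernaryQuartic

/-! Part 1 is the Gram matrix method: `p` is a sum of squares exactly when `p = mᵀ G m` for a
positive semidefinite `G`, with `m` the vector of quadratic monomials, and `A₀ + W` is the set of
symmetric `G` representing `p` (`mem_add_W_iff`).

Part 2 (Hilbert) is an extremal argument. The positive semidefinite `G` with `mᵀ G m ≤ F` form a
compact set, so some `G` has maximal trace. If the residual `F - mᵀ G m` were not zero, it would
dominate `(c ⬝ᵥ m)²` for some `c ≠ 0`, and `G + c cᵀ` would have larger trace.

The core is thus `IsNonnegQuartic.dominatesSquare`. Without nontrivial zeros, compactness of the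
sphere gives `ε z⁴ ≤ F`. At a zero placed at `(1, 0, 0)`, `F = f x² + g x + h` with `f, g, h` forms
in `y, z`. If `f` degenerates, `F` is constant on an affine line and can be treated explicitly.
Otherwise minimizing over `x` either leaves a positive bound, or yields a further zero or such a
line; three independent zeros allow completing a square. -/

namespace TernaryQuartic

open MvPolynomial

/-! ### Ternary forms as functions, and their coefficients -/

/-- `F` is the function of a real ternary form of degree `d`. -/
def IsForm (d : ℕ) (F : (Fin 3 → ℝ) → ℝ) : Prop :=
  ∃ p : MvPolynomial (Fin 3) ℝ, p.IsHomogeneous d ∧ ∀ v, F v = eval v p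

theorem IsForm.comp_linear {d : ℕ} {F : (Fin 3 → ℝ) → ℝ} (hF : IsForm d F)
    (T : (Fin 3 → ℝ) →ₗ[ℝ] (Fin 3 → ℝ)) : IsForm d (fun v => F (T v)) := by
  obtain ⟨p, hp, h⟩ := hF
  refine ⟨aeval (fun i => ∑ j, C (T (Pi.single j 1) i) * X j) p, ?_, fun v => ?_⟩
  · have := hp.aeval (S := ℝ) (n := 1) (fun i => ∑ j : Fin 3, C (T (Pi.single j 1) i) * X j)
      (fun i => IsHomogeneous.sum _ _ _ fun j _ => by
        simpa using (isHomogeneous_C (Fin 3) (T (Pi.single j 1) i)).mul (isHomogeneous_X ℝ j))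
    simpa using this
  · have hv : T v = fun i => eval v (∑ j, C (T (Pi.single j 1) i) * X j) := by
      ext i
      conv_lhs => rw [LinearMap.pi_apply_eq_sum_univ T v]
      have he (x : Fin 3) : (fun j => if x = j then (1 : ℝ) else 0) = Pi.single x 1 := by
        ext j; simp [Pi.single_apply, eq_comm]
      simp [Finset.sum_apply, mul_comm, he]
    change F (T v) = _
    rw [h, hv, ← coe_aeval_eq_eval, ← coe_aeval_eq_eval]
    simp only [RingHom.coe_coe]
    exact (DFunLike.congr_fun (comp_aeval (aeval v : MvPolynomial (Fin 3) ℝ →ₐ[ℝ] ℝ) (f := fun i =>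
      ∑ j, C (T (Pi.single j 1) i) * X j)) p).symm

theorem IsForm.continuous {d : ℕ} {F : (Fin 3 → ℝ) → ℝ} (hF : IsForm d F) : Continuous F := by
  obtain ⟨p, hp, h⟩ := hF
  rw [show F = fun v => eval v p from funext h]
  exact p.continuous_eval

/-- Nested antidiagonals let `simp` unfold the sum into explicit monomials once the degree is a
numeral. -/
theorem eval_eq_sum_antidiagonal {p : MvPolynomial (Fin 3) ℝ} {d : ℕ} (hp : p.IsHomogeneous d)
    (v : Fin 3 → ℝ) :
    eval v p = ∑ m ∈ Finset.HasAntidiagonal.antidiagonal d, ∑ l ∈ Finset.HasAntidiagonal.antidiagonal m.2,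
      pcoeff p m.1 l.1 l.2 * (v 0 ^ m.1 * v 1 ^ l.1 * v 2 ^ l.2) := by
  rw [eval_eq', Finset.sum_sigma']
  refine Finset.sum_bij_ne_zero (fun e _ _ => ⟨(e 0, e 1 + e 2), (e 1, e 2)⟩) ?_ ?_ ?_ ?_
  · intro e he _
    have := hp (mem_support_iff.1 he)
    simp [Finsupp.weight_apply, Finsupp.sum_fintype, Fin.sum_univ_three] at this ⊢
    omega
  · intro a _ _ b _ _ hab
    simp at hab
    ext i
    fin_cases i <;> simp <;> omega
  · rintro ⟨⟨i, m⟩, ⟨j, k⟩⟩ hm hne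
    simp only [Finset.mem_sigma, Finset.HasAntidiagonal.mem_antidiagonal] at hm
    have hc : pcoeff p i j k ≠ 0 := left_ne_zero_of_mul hne
    refine ⟨_, mem_support_iff.2 hc, ?_, ?_⟩
    · simpa [Fin.prod_univ_three, pcoeff] using hne
    · simp [hm.2]
  · intro e _ _
    simp only [pcoeff, Fin.prod_univ_three]
    congr 2
    ext i
    fin_cases i <;> simp

theorem IsForm.smul {d : ℕ} {F : (Fin 3 → ℝ) → ℝ} (hF : IsForm d F) (t : ℝ) (v : Fin 3 → ℝ) :
    F (t • v) = t ^ d * F v := by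
  obtain ⟨p, hp, h⟩ := hF
  rw [h, h, eval_eq_sum_antidiagonal hp, eval_eq_sum_antidiagonal hp, Finset.mul_sum]
  refine Finset.sum_congr rfl fun m hm => ?_
  rw [Finset.mul_sum]
  refine Finset.sum_congr rfl fun l hl => ?_
  rw [← Finset.HasAntidiagonal.mem_antidiagonal.1 hm, ← Finset.HasAntidiagonal.mem_antidiagonal.1 hl]
  simp only [Pi.smul_apply, smul_eq_mul, mul_pow, pow_add]
  ring

theorem eval_quartic {p : MvPolynomial (Fin 3) ℝ} (hp : p.IsHomogeneous 4) (x y z : ℝ) :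
    eval ![x, y, z] p =
      pcoeff p 4 0 0 * x ^ 4 + pcoeff p 3 1 0 * x ^ 3 * y + pcoeff p 3 0 1 * x ^ 3 * z +
      pcoeff p 2 2 0 * x ^ 2 * y ^ 2 + pcoeff p 2 1 1 * x ^ 2 * y * z +
      pcoeff p 2 0 2 * x ^ 2 * z ^ 2 + pcoeff p 1 3 0 * x * y ^ 3 +
      pcoeff p 1 2 1 * x * y ^ 2 * z + pcoeff p 1 1 2 * x * y * z ^ 2 +
      pcoeff p 1 0 3 * x * z ^ 3 + pcoeff p 0 4 0 * y ^ 4 + pcoeff p 0 3 1 * y ^ 3 * z +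
      pcoeff p 0 2 2 * y ^ 2 * z ^ 2 + pcoeff p 0 1 3 * y * z ^ 3 + pcoeff p 0 0 4 * z ^ 4 := by
  rw [eval_eq_sum_antidiagonal hp]
  simp [Finset.Nat.antidiagonal_succ]
  ring

/-- The six monomials of degree two. -/
def monomials (v : Fin 3 → ℝ) : Fin 6 → ℝ :=
  ![v 0 ^ 2, v 0 * v 1, v 0 * v 2, v 1 ^ 2, v 1 * v 2, v 2 ^ 2]

theorem IsForm.exists_dotProduct {q : (Fin 3 → ℝ) → ℝ} (hq : IsForm 2 q) :
    ∃ c : Fin 6 → ℝ, ∀ v, q v = c ⬝ᵥ monomials v := by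
  obtain ⟨p, hp, h⟩ := hq
  refine ⟨![pcoeff p 2 0 0, pcoeff p 1 1 0, pcoeff p 1 0 1, pcoeff p 0 2 0, pcoeff p 0 1 1,
    pcoeff p 0 0 2], fun v => ?_⟩
  rw [h, eval_eq_sum_antidiagonal hp]
  simp [Finset.Nat.antidiagonal_succ, monomials, dotProduct, Fin.sum_univ_six]
  ring

/-- The quadratic form with coefficient vector `c`. -/
noncomputable def quadraticForm (c : Fin 6 → ℝ) : MvPolynomial (Fin 3) ℝ :=
  C (c 0) * X 0 ^ 2 + C (c 1) * (X 0 * X 1) + C (c 2) * (X 0 * X 2) + C (c 3) * X 1 ^ 2 +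
    C (c 4) * (X 1 * X 2) + C (c 5) * X 2 ^ 2

theorem quadraticForm_isHomogeneous (c : Fin 6 → ℝ) : (quadraticForm c).IsHomogeneous 2 := by
  have hX (i j : Fin 3) (a : ℝ) : (C a * (X i * X j) : MvPolynomial (Fin 3) ℝ).IsHomogeneous 2 := by
    simpa using (isHomogeneous_C _ a).mul ((isHomogeneous_X ℝ i).mul (isHomogeneous_X ℝ j))
  simp only [quadraticForm, sq]
  exact (((((hX _ _ _).add (hX _ _ _)).add (hX _ _ _)).add (hX _ _ _)).add (hX _ _ _)).add (hX _ _ _)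

theorem eval_quadraticForm (c : Fin 6 → ℝ) (v : Fin 3 → ℝ) :
    eval v (quadraticForm c) = c ⬝ᵥ monomials v := by
  simp [quadraticForm, monomials, dotProduct, Fin.sum_univ_six]

/-! ### Dominated squares and linear changes of coordinates -/

/-- `F` dominates the square of a nonzero quadratic form. -/
def DominatesSquare (F : (Fin 3 → ℝ) → ℝ) : Prop :=
  ∃ q, IsForm 2 q ∧ (∃ v, q v ≠ 0) ∧ ∀ v, q v ^ 2 ≤ F v

theorem DominatesSquare.of_comp {F : (Fin 3 → ℝ) → ℝ} (T : (Fin 3 → ℝ) ≃ₗ[ℝ] (Fin 3 → ℝ))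
    (h : DominatesSquare fun v => F (T v)) : DominatesSquare F := by
  obtain ⟨q, hq, ⟨v, hv⟩, hle⟩ := h
  exact ⟨fun v => q (T.symm v), hq.comp_linear T.symm.toLinearMap, ⟨T v, by simpa using hv⟩,
    fun v => by simpa using hle (T.symm v)⟩

theorem eq_zero_of_dotProduct_monomials {c : Fin 6 → ℝ} (h : ∀ v, c ⬝ᵥ monomials v = 0) :
    c = 0 := by
  have h1 := h ![1, 0, 0]
  have h2 := h ![0, 1, 0]
  have h3 := h ![0, 0, 1]
  have h4 := h ![1, 1, 0]
  have h5 := h ![1, 0, 1]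
  have h6 := h ![0, 1, 1]
  simp [monomials, dotProduct, Fin.sum_univ_six] at h1 h2 h3 h4 h5 h6
  ext i
  fin_cases i <;> simp <;> linarith

theorem DominatesSquare.of_coeffs {F : (Fin 3 → ℝ) → ℝ} (c : Fin 6 → ℝ) (hc : c ≠ 0)
    (h : ∀ x y z, (c 0 * x ^ 2 + c 1 * (x * y) + c 2 * (x * z) + c 3 * y ^ 2 + c 4 * (y * z) +
      c 5 * z ^ 2) ^ 2 ≤ F ![x, y, z]) : DominatesSquare F := by
  refine ⟨fun v => c ⬝ᵥ monomials v, ⟨_, quadraticForm_isHomogeneous c, fun v =>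
    (eval_quadraticForm c v).symm⟩, ?_, fun v => ?_⟩
  · by_contra! h0
    exact hc (eq_zero_of_dotProduct_monomials h0)
  have hv : v = ![v 0, v 1, v 2] := by ext i; fin_cases i <;> rfl
  have := h (v 0) (v 1) (v 2)
  rw [← hv] at this
  simpa [monomials, dotProduct, Fin.sum_univ_six] using this

theorem exists_linearEquiv_of_triple {u v w : Fin 3 → ℝ} (h : LinearIndependent ℝ ![u, v, w]) :
    ∃ T : (Fin 3 → ℝ) ≃ₗ[ℝ] (Fin 3 → ℝ), ∀ x y z : ℝ, T ![x, y, z] = x • u + y • v + z • w := by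
  let b := basisOfLinearIndependentOfCardEqFinrank h (by simp)
  refine ⟨b.equivFun.symm, fun x y z => ?_⟩
  simp [b, Module.Basis.equivFun_symm_apply, Fin.sum_univ_three]

theorem exists_linearEquiv_of_pair {u v : Fin 3 → ℝ} (h : LinearIndependent ℝ ![u, v]) :
    ∃ T : (Fin 3 → ℝ) ≃ₗ[ℝ] (Fin 3 → ℝ), T ![1, 0, 0] = u ∧ T ![0, 1, 0] = v := by
  obtain ⟨w, hw⟩ := exists_linearIndependent_snoc_of_lt_finrank h (by simp)
  have : (Fin.snoc ![u, v] w : Fin 3 → Fin 3 → ℝ) = ![u, v, w] := by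
    ext i; fin_cases i <;> rfl
  obtain ⟨T, hT⟩ := exists_linearEquiv_of_triple (this ▸ hw)
  exact ⟨T, by simp [hT], by simp [hT]⟩

theorem exists_linearEquiv_of_ne_zero {u : Fin 3 → ℝ} (h : u ≠ 0) :
    ∃ T : (Fin 3 → ℝ) ≃ₗ[ℝ] (Fin 3 → ℝ), T ![1, 0, 0] = u := by
  have h1 : LinearIndependent ℝ ![u] := by simpa using h
  obtain ⟨w, hw⟩ := exists_linearIndependent_snoc_of_lt_finrank h1 (by simp)
  have : (Fin.snoc ![u] w : Fin 2 → Fin 3 → ℝ) = ![u, w] := by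
    ext i; fin_cases i <;> rfl
  obtain ⟨T, hT, -⟩ := exists_linearEquiv_of_pair (this ▸ hw)
  exact ⟨T, hT⟩

/-! ### Lower bounds by homogeneity, and nonnegative polynomials of low degree -/

/-- A continuous positive function, homogeneous of degree `k`, is bounded below by a multiple of the
`k`-th power of the norm. -/
theorem exists_le_of_homogeneous {E : Type*} [NormedAddCommGroup E] [NormedSpace ℝ E]
    [FiniteDimensional ℝ E] {φ : E → ℝ} {k : ℕ} (hc : ContinuousOn φ {0}ᶜ)
    (hhom : ∀ t : ℝ, ∀ v, φ (t • v) = t ^ k * φ v) (hpos : ∀ v, v ≠ 0 → 0 < φ v) :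
    ∃ ε > 0, ∀ v, v ≠ 0 → ε * ‖v‖ ^ k ≤ φ v := by
  have : ProperSpace E := FiniteDimensional.proper ℝ E
  rcases (Metric.sphere (0 : E) 1).eq_empty_or_nonempty with he | hne
  · refine ⟨1, one_pos, fun v hv => ?_⟩
    have : ‖v‖⁻¹ • v ∈ Metric.sphere (0 : E) 1 := by
      simp [norm_smul, norm_ne_zero_iff.2 hv]
    simp [he] at this
  have hsub : Metric.sphere (0 : E) 1 ⊆ {0}ᶜ := fun v hv h0 => by
    simp [Set.mem_singleton_iff.1 h0] at hv
  obtain ⟨w, hw, hmin⟩ := (isCompact_sphere (0 : E) 1).exists_isMinOn hne (hc.mono hsub)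
  refine ⟨φ w, hpos w (hsub hw), fun v hv => ?_⟩
  have hn := norm_ne_zero_iff.2 hv
  have hm : ‖v‖⁻¹ • v ∈ Metric.sphere (0 : E) 1 := by simp [norm_smul, hn]
  have h1 : φ w ≤ φ (‖v‖⁻¹ • v) := hmin hm
  have h2 : φ v = ‖v‖ ^ k * φ (‖v‖⁻¹ • v) := by rw [← hhom, smul_inv_smul₀ hn]
  rw [h2, mul_comm]
  gcongr

theorem eq_zero_of_linear_nonneg {a b : ℝ} (h : ∀ x : ℝ, 0 ≤ a * x + b) : a = 0 := by
  by_contra ha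
  -- At this point the linear polynomial takes the value `-1`.
  have := h (-(b + 1) / a)
  rw [mul_div_cancel₀ _ ha] at this
  linarith

theorem sq_le_of_quadratic_nonneg {a b c : ℝ} (h : ∀ x : ℝ, 0 ≤ a * x ^ 2 + b * x + c) :
    b ^ 2 ≤ 4 * a * c := by
  have := discrim_le_zero (a := a) (b := b) (c := c) fun x => by simpa [sq] using h x
  rw [discrim] at this
  linarith

theorem leadingCoeff_nonneg_of_quadratic_nonneg {a b c : ℝ}
    (h : ∀ x : ℝ, 0 ≤ a * x ^ 2 + b * x + c) : 0 ≤ a := by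
  have h1 := sq_le_of_quadratic_nonneg h
  have h2 := h 1
  have h3 := h (-1)
  by_contra! ha
  have hc : 0 ≤ c := by simpa using h 0
  nlinarith [sq_nonneg b]

theorem eq_zero_of_cubic_nonneg {l a b c : ℝ}
    (h : ∀ x : ℝ, 0 ≤ l * x ^ 3 + a * x ^ 2 + b * x + c) : l = 0 := by
  -- A one-sided bound suffices: substituting `-x` flips the signs of `l` and `b` together, hence
  -- the quantification over both.
  have key : ∀ l b : ℝ, (∀ x : ℝ, 0 ≤ l * x ^ 3 + a * x ^ 2 + b * x + c) → 0 ≤ l := by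
    intro l b h
    by_contra! hl
    -- At `t = M / -l + 1 ≥ 1` the cubic term is at most `-M t²`, while the others total at most `(M
    -- - 1) t²`.
    set M := |a| + |b| + |c| + 1 with hM
    have hM1 : 0 < M := by positivity
    have hx : 0 ≤ M / -l := by apply div_nonneg hM1.le; linarith
    have h1 := h (M / -l + 1)
    have hl0 : l ≠ 0 := hl.ne
    have h2 : l * (M / -l) = -M := by rw [div_neg, mul_neg, mul_div_cancel₀ _ hl0]
    set x := M / -l
    have h3 : l * (x + 1) ≤ -M := by linarith
    have h4 : l * (x + 1) ^ 3 ≤ -M * (x + 1) ^ 2 := by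
      have := mul_le_mul_of_nonneg_right h3 (sq_nonneg (x + 1))
      linarith
    have h5 : a * (x + 1) ^ 2 ≤ |a| * (x + 1) ^ 2 := by gcongr; exact le_abs_self a
    have hx1 : x + 1 ≤ (x + 1) ^ 2 := by nlinarith
    have h6 : b * (x + 1) ≤ |b| * (x + 1) ^ 2 :=
      mul_le_mul (le_abs_self b) hx1 (by linarith) (abs_nonneg b)
    have h7 : c ≤ |c| * (x + 1) ^ 2 := by
      nlinarith [le_abs_self c, abs_nonneg c]
    have h8 : M * (x + 1) ^ 2 = |a| * (x + 1) ^ 2 + |b| * (x + 1) ^ 2 + |c| * (x + 1) ^ 2 +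
      (x + 1) ^ 2 := by rw [hM]; ring
    nlinarith
  have h1 := key l b h
  have h2 := key (-l) (-b) fun x => by have := h (-x); linarith
  linarith

/-- Used to cancel a factor such as `z²` from an inequality and still keep it at `z = 0`. -/
theorem nonneg_of_forall_ne_zero {φ : ℝ → ℝ} (hφ : Continuous φ) (h : ∀ z, z ≠ 0 → 0 ≤ φ z)
    (z : ℝ) : 0 ≤ φ z := by
  have hd : Dense ({0}ᶜ : Set ℝ) := dense_compl_singleton 0
  have hc : IsClosed {z | 0 ≤ φ z} := isClosed_le continuous_const hφ
  exact hc.closure_subset_iff.2 (fun z hz => h z hz) (hd z)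

theorem exists_mul_pow_le {φ : ℝ × ℝ → ℝ} {k : ℕ} (hc : ContinuousOn φ {0}ᶜ)
    (hhom : ∀ t y z : ℝ, φ (t * y, t * z) = t ^ k * φ (y, z)) (hpos : ∀ v, v ≠ 0 → 0 < φ v) :
    ∃ ε > 0, ∀ y z, (y, z) ≠ (0 : ℝ × ℝ) → ε * |z| ^ k ≤ φ (y, z) := by
  obtain ⟨ε, hε, h⟩ := exists_le_of_homogeneous hc (fun t v => hhom t v.1 v.2) hpos
  refine ⟨ε, hε, fun y z hv => le_trans ?_ (h _ hv)⟩
  gcongr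
  exact norm_snd_le (y, z)

/-! ### Nonnegative quartics constant along a line -/

/-- Nonzero ternary quartic forms with nonnegative values. -/
structure IsNonnegQuartic (F : (Fin 3 → ℝ) → ℝ) : Prop where
  isForm : IsForm 4 F
  nonneg : ∀ v, 0 ≤ F v
  ne_zero : ∃ v, F v ≠ 0

theorem IsNonnegQuartic.comp {F : (Fin 3 → ℝ) → ℝ} (hF : IsNonnegQuartic F)
    (T : (Fin 3 → ℝ) ≃ₗ[ℝ] (Fin 3 → ℝ)) : IsNonnegQuartic fun v => F (T v) where
  isForm := hF.isForm.comp_linear T.toLinearMap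
  nonneg v := hF.nonneg _
  ne_zero := by
    obtain ⟨v, hv⟩ := hF.ne_zero
    exact ⟨T.symm v, by simpa using hv⟩

theorem IsForm.exists_coeffs {F : (Fin 3 → ℝ) → ℝ} (hF : IsForm 4 F) :
    ∃ a₁ a₂ a₃ a₄ a₅ a₆ a₇ a₈ a₉ a₁₀ a₁₁ a₁₂ a₁₃ a₁₄ a₁₅ : ℝ, ∀ x y z, F ![x, y, z] =
      a₁ * x ^ 4 + a₂ * x ^ 3 * y + a₃ * x ^ 3 * z + a₄ * x ^ 2 * y ^ 2 + a₅ * x ^ 2 * y * z +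
      a₆ * x ^ 2 * z ^ 2 + a₇ * x * y ^ 3 + a₈ * x * y ^ 2 * z + a₉ * x * y * z ^ 2 +
      a₁₀ * x * z ^ 3 + a₁₁ * y ^ 4 + a₁₂ * y ^ 3 * z + a₁₃ * y ^ 2 * z ^ 2 + a₁₄ * y * z ^ 3 +
      a₁₅ * z ^ 4 := by
  obtain ⟨p, hp, h⟩ := hF
  exact ⟨_, _, _, _, _, _, _, _, _, _, _, _, _, _, _, fun x y z => by rw [h, eval_quartic hp]⟩

theorem vec_eq (v : Fin 3 → ℝ) : v = ![v 0, v 1, v 2] := by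
  ext i; fin_cases i <;> rfl

theorem DominatesSquare.of_pow_le {F : (Fin 3 → ℝ) → ℝ} {ε : ℝ} (hε : 0 < ε)
    (h : ∀ x y z, ε * z ^ 4 ≤ F ![x, y, z]) : DominatesSquare F := by
  refine .of_coeffs ![0, 0, 0, 0, 0, √ε] (fun h0 => ?_) fun x y z => ?_
  · have := congrFun h0 5
    simp at this
    linarith [Real.sqrt_eq_zero'.1 this]
  · have := h x y z
    simp [mul_pow, Real.sq_sqrt hε.le]
    linarith [show ε * (z ^ 2) ^ 2 = ε * z ^ 4 by ring]

theorem smul_add_vec (s x y z x' y' z' : ℝ) :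
    s • ![x, y, z] + ![x', y', z'] = ![s * x + x', s * y + y', s * z + z'] := by
  ext i; fin_cases i <;> simp

/-- A zero of a nonnegative binary form is at least double, so `z²` splits off. The remaining
quadratic in `y, z` is nonnegative: complete its square in `y`, or, if it has no `y²` term, only a
multiple of `z⁴` survives. -/
theorem IsNonnegQuartic.dominatesSquare_of_cylinder_coords {F : (Fin 3 → ℝ) → ℝ}
    (hF : IsNonnegQuartic F) (hu : ∀ x y z : ℝ, F ![x, y, z] = F ![0, y, z])
    (hw : F ![0, 1, 0] = 0) : DominatesSquare F := by
  obtain ⟨_, _, _, _, _, _, _, _, _, _, h₀, h₁, h₂, h₃, h₄, h⟩ := hF.isForm.exists_coeffs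
  replace h (x y z : ℝ) : F ![x, y, z] = h₀ * y ^ 4 + h₁ * y ^ 3 * z + h₂ * y ^ 2 * z ^ 2 +
      h₃ * y * z ^ 3 + h₄ * z ^ 4 := by rw [hu, h]; ring
  have hnn (x y z : ℝ) := h x y z ▸ hF.nonneg ![x, y, z]
  obtain rfl : h₀ = 0 := by simpa [hw] using (h 0 1 0).symm
  obtain rfl : h₁ = 0 := eq_zero_of_cubic_nonneg (a := h₂) (b := h₃) (c := h₄) fun y => by
    linarith [hnn 0 y 1]
  have hq (y : ℝ) : 0 ≤ h₂ * y ^ 2 + h₃ * y + h₄ := by linarith [hnn 0 y 1]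
  have hd := sq_le_of_quadratic_nonneg hq
  rcases (leadingCoeff_nonneg_of_quadratic_nonneg hq).eq_or_lt with rfl | h2
  · obtain rfl : h₃ = 0 := by
      have : h₃ ^ 2 ≤ 0 := by linarith
      exact pow_eq_zero_iff two_ne_zero |>.1 (le_antisymm this (sq_nonneg _))
    refine .of_pow_le (ε := h₄) ((by simpa using hq 0 : 0 ≤ h₄).lt_of_ne ?_) fun x y z => ?_
    · rintro rfl
      obtain ⟨v, hv⟩ := hF.ne_zero
      rw [vec_eq v, h] at hv
      simp at hv
    · rw [h]; linarith
  · have hr : 0 < √h₂ := Real.sqrt_pos.2 h2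
    have hr2 : √h₂ ^ 2 = h₂ := Real.sq_sqrt h2.le
    refine .of_coeffs ![0, 0, 0, 0, √h₂, h₃ / (2 * √h₂)] (fun h0 => ?_) fun x y z => ?_
    · exact hr.ne' (congrFun h0 4)
    · rw [h]
      simp only [Matrix.cons_val]
      generalize √h₂ = r at *
      subst hr2
      have h3 : (h₃ / (2 * r)) ^ 2 ≤ h₄ := by
        rw [div_pow, div_le_iff₀ (by positivity)]; linarith
      have h4 : (0 * x ^ 2 + 0 * (x * y) + 0 * (x * z) + 0 * y ^ 2 + r * (y * z) +
          h₃ / (2 * r) * z ^ 2) ^ 2 = r ^ 2 * y ^ 2 * z ^ 2 + h₃ * y * z ^ 3 +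
          (h₃ / (2 * r)) ^ 2 * z ^ 4 := by
        field_simp; ring
      rw [h4]
      nlinarith [mul_le_mul_of_nonneg_right h3 (by positivity : 0 ≤ z ^ 4)]

/-- The case of a form in two variables with a zero. -/
theorem IsNonnegQuartic.dominatesSquare_of_cylinder {F : (Fin 3 → ℝ) → ℝ}
    (hF : IsNonnegQuartic F) {u w : Fin 3 → ℝ} (huw : LinearIndependent ℝ ![u, w])
    (hu : ∀ (s : ℝ) v, F (s • u + v) = F v) (hw : F w = 0) : DominatesSquare F := by
  obtain ⟨T, rfl, rfl⟩ := exists_linearEquiv_of_pair huw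
  refine .of_comp T ((hF.comp T).dominatesSquare_of_cylinder_coords (fun x y z => ?_) hw)
  rw [← hu x (T ![0, y, z]), ← map_smul, ← map_add, smul_add_vec]
  simp

theorem linearIndependent_pair_of_ne_zero {y z : ℝ} (h : (y, z) ≠ (0 : ℝ × ℝ)) (x : ℝ) :
    LinearIndependent ℝ ![![1, 0, 0], ![x, y, z]] := by
  rw [LinearIndependent.pair_iff]
  intro s t hst
  have h0 := congrFun hst 0
  have h1 := congrFun hst 1
  have h2 := congrFun hst 2
  simp at h0 h1 h2
  have ht : t = 0 := by
    by_contra ht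
    exact h (by simp [h1.resolve_left ht, h2.resolve_left ht])
  simpa [ht] using h0

theorem IsNonnegQuartic.dominatesSquare_of_line_coords {F : (Fin 3 → ℝ) → ℝ}
    (hF : IsNonnegQuartic F) (hu : ∀ s : ℝ, F ![s, 1, 0] = F ![0, 1, 0]) : DominatesSquare F := by
  obtain ⟨a₁, a₂, a₃, a₄, a₅, c, a₇, g₁, g₂, g₃, h₀, h₁, h₂, h₃, h₄, h⟩ := hF.isForm.exists_coeffs
  simp only [h] at hu
  -- Four nonzero values of `s` kill a quartic polynomial in `s` without constant term.
  have e1 := hu 1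
  have e2 := hu (-1)
  have e3 := hu 2
  have e4 := hu (-2)
  obtain rfl : a₁ = 0 := by linarith
  obtain rfl : a₂ = 0 := by linarith
  obtain rfl : a₄ = 0 := by linarith
  obtain rfl : a₇ = 0 := by linarith
  clear hu e1 e2 e3 e4
  have hnn (x y z : ℝ) := h x y z ▸ hF.nonneg ![x, y, z]
  obtain rfl : a₃ = 0 := eq_zero_of_cubic_nonneg (a := c) (b := g₃) (c := h₄) fun x => by
    linarith [hnn x 0 1]
  -- At `z = 1` the coefficient of `x²` is `a₅ y + c`, which must be nonnegative for every `y`.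
  obtain rfl : a₅ = 0 := eq_zero_of_linear_nonneg (b := c) fun y =>
    leadingCoeff_nonneg_of_quadratic_nonneg (b := g₁ * y ^ 2 + g₂ * y + g₃)
      (c := h₀ * y ^ 4 + h₁ * y ^ 3 + h₂ * y ^ 2 + h₃ * y + h₄) fun x => by linarith [hnn x y 1]
  have hc : 0 ≤ c := leadingCoeff_nonneg_of_quadratic_nonneg (b := g₃) (c := h₄) fun x => by
    linarith [hnn x 0 1]
  have hd (y z : ℝ) := sq_le_of_quadratic_nonneg (a := c * z ^ 2)
    (b := z * (g₁ * y ^ 2 + g₂ * y * z + g₃ * z ^ 2))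
    (c := h₀ * y ^ 4 + h₁ * y ^ 3 * z + h₂ * y ^ 2 * z ^ 2 + h₃ * y * z ^ 3 + h₄ * z ^ 4)
    fun x => by linarith [hnn x y z]
  rcases hc.eq_or_lt with rfl | hc
  · have hg (y : ℝ) : g₁ * y ^ 2 + g₂ * y + g₃ = 0 := by
      have := hd y 1
      exact pow_eq_zero_iff two_ne_zero |>.1 (le_antisymm (by linarith) (sq_nonneg _))
    obtain rfl : g₃ = 0 := by simpa using hg 0
    have e1 := hg 1
    have e2 := hg (-1)
    obtain rfl : g₁ = 0 := by linarith
    obtain rfl : g₂ = 0 := by linarith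
    -- Now `F` does not involve `x`: it is a binary form, with or without a nontrivial zero.
    by_cases hz : ∃ y z, (y, z) ≠ (0 : ℝ × ℝ) ∧ F ![0, y, z] = 0
    · obtain ⟨y, z, hyz, h0⟩ := hz
      refine hF.dominatesSquare_of_cylinder (linearIndependent_pair_of_ne_zero hyz 0)
        (fun s v => ?_) h0
      rw [vec_eq v, smul_add_vec, h, h]
      ring
    · push Not at hz
      obtain ⟨ε, hε, hle⟩ := exists_mul_pow_le (φ := fun v => F ![0, v.1, v.2]) (k := 4)
        (by simp only [h]; fun_prop) (fun t y z => by simp only [h]; ring)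
        (fun v hv => (hF.nonneg _).lt_of_ne' (hz v.1 v.2 hv))
      refine .of_pow_le hε fun x y z => ?_
      by_cases hyz : (y, z) = (0 : ℝ × ℝ)
      · simp only [Prod.mk_eq_zero] at hyz
        simpa [hyz] using hF.nonneg ![x, 0, 0]
      · have := hle y z hyz
        rw [Even.pow_abs (by decide)] at this
        refine this.trans (le_of_eq ?_)
        rw [h, h]; ring
  · have hr : 0 < √c := Real.sqrt_pos.2 hc
    have hr2 : √c ^ 2 = c := Real.sq_sqrt hc.le
    have hD (y z : ℝ) : 0 ≤ 4 * c * (h₀ * y ^ 4 + h₁ * y ^ 3 * z + h₂ * y ^ 2 * z ^ 2 +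
        h₃ * y * z ^ 3 + h₄ * z ^ 4) - (g₁ * y ^ 2 + g₂ * y * z + g₃ * z ^ 2) ^ 2 := by
      refine nonneg_of_forall_ne_zero (φ := fun z => 4 * c * (h₀ * y ^ 4 + h₁ * y ^ 3 * z +
        h₂ * y ^ 2 * z ^ 2 + h₃ * y * z ^ 3 + h₄ * z ^ 4) -
        (g₁ * y ^ 2 + g₂ * y * z + g₃ * z ^ 2) ^ 2) (by fun_prop) (fun z hz => ?_) z
      have hz2 : 0 < z ^ 2 := by positivity
      refine (mul_nonneg_iff_of_pos_right hz2).1 ?_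
      have := hd y z
      linarith
    -- The square completed in `x z`; what is left over is the discriminant `hD` divided by `4 c`.
    refine .of_coeffs ![0, 0, √c, g₁ / (2 * √c), g₂ / (2 * √c), g₃ / (2 * √c)] (fun h0 => ?_)
      fun x y z => ?_
    · exact hr.ne' (congrFun h0 2)
    · rw [h]
      simp only [Matrix.cons_val]
      have := hD y z
      generalize √c = r at *
      subst hr2
      have h4 : (0 * x ^ 2 + 0 * (x * y) + r * (x * z) + g₁ / (2 * r) * y ^ 2 +
          g₂ / (2 * r) * (y * z) + g₃ / (2 * r) * z ^ 2) ^ 2 = r ^ 2 * x ^ 2 * z ^ 2 +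
          x * z * (g₁ * y ^ 2 + g₂ * y * z + g₃ * z ^ 2) +
          (g₁ * y ^ 2 + g₂ * y * z + g₃ * z ^ 2) ^ 2 / (4 * r ^ 2) := by
        field_simp; ring
      have h5 : (g₁ * y ^ 2 + g₂ * y * z + g₃ * z ^ 2) ^ 2 / (4 * r ^ 2) ≤ h₀ * y ^ 4 +
          h₁ * y ^ 3 * z + h₂ * y ^ 2 * z ^ 2 + h₃ * y * z ^ 3 + h₄ * z ^ 4 := by
        rw [div_le_iff₀ (by positivity)]; linarith
      rw [h4]
      linarith

/-- The case of a form that is constant on an affine line not through the origin. -/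
theorem IsNonnegQuartic.dominatesSquare_of_line {F : (Fin 3 → ℝ) → ℝ}
    (hF : IsNonnegQuartic F) {u w : Fin 3 → ℝ} (huw : LinearIndependent ℝ ![u, w])
    (hu : ∀ s : ℝ, F (s • u + w) = F w) : DominatesSquare F := by
  obtain ⟨T, rfl, rfl⟩ := exists_linearEquiv_of_pair huw
  refine .of_comp T ((hF.comp T).dominatesSquare_of_line_coords fun s => ?_)
  rw [← hu s, ← map_smul, ← map_add, smul_add_vec]
  simp

/-! ### Quartics with one, two or three zeros -/

/-- The normal form of a nonnegative quartic at a zero that is not degenerate. -/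
theorem IsNonnegQuartic.dominatesSquare_or_exists_coeffs {F : (Fin 3 → ℝ) → ℝ}
    (hF : IsNonnegQuartic F) (h0 : F ![1, 0, 0] = 0) : DominatesSquare F ∨
    ∃ a b c g₀ g₁ g₂ g₃ h₀ h₁ h₂ h₃ h₄ : ℝ,
      (∀ y z : ℝ, (y, z) ≠ (0 : ℝ × ℝ) → 0 < a * y ^ 2 + b * y * z + c * z ^ 2) ∧
      ∀ x y z, F ![x, y, z] = (a * y ^ 2 + b * y * z + c * z ^ 2) * x ^ 2 +
        (g₀ * y ^ 3 + g₁ * y ^ 2 * z + g₂ * y * z ^ 2 + g₃ * z ^ 3) * x +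
        (h₀ * y ^ 4 + h₁ * y ^ 3 * z + h₂ * y ^ 2 * z ^ 2 + h₃ * y * z ^ 3 + h₄ * z ^ 4) := by
  obtain ⟨a₁, a₂, a₃, a, b, c, g₀, g₁, g₂, g₃, h₀, h₁, h₂, h₃, h₄, h⟩ := hF.isForm.exists_coeffs
  have hnn (x y z : ℝ) := h x y z ▸ hF.nonneg ![x, y, z]
  obtain rfl : a₁ = 0 := by simpa [h] using h0
  obtain rfl : a₂ = 0 := eq_zero_of_cubic_nonneg (a := a) (b := g₀) (c := h₀) fun x => by
    linarith [hnn x 1 0]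
  obtain rfl : a₃ = 0 := eq_zero_of_cubic_nonneg (a := c) (b := g₃) (c := h₄) fun x => by
    linarith [hnn x 0 1]
  have hq (x y z : ℝ) : 0 ≤ (a * y ^ 2 + b * y * z + c * z ^ 2) * x ^ 2 +
        (g₀ * y ^ 3 + g₁ * y ^ 2 * z + g₂ * y * z ^ 2 + g₃ * z ^ 3) * x +
        (h₀ * y ^ 4 + h₁ * y ^ 3 * z + h₂ * y ^ 2 * z ^ 2 + h₃ * y * z ^ 3 + h₄ * z ^ 4) := by
    linarith [hnn x y z]
  by_cases hf : ∃ y z, (y, z) ≠ (0 : ℝ × ℝ) ∧ a * y ^ 2 + b * y * z + c * z ^ 2 = 0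
  · obtain ⟨y, z, hyz, hf⟩ := hf
    refine .inl (hF.dominatesSquare_of_line (linearIndependent_pair_of_ne_zero hyz 0) fun s => ?_)
    -- Where `f` vanishes, `F` is linear in `x` and nonnegative, so `g` vanishes too and `F` is
    -- constant in `x`.
    have hg := eq_zero_of_linear_nonneg fun x => by simpa [hf] using hq x y z
    rw [smul_add_vec, h, h]
    linear_combination s ^ 2 * hf + s * hg
  · push Not at hf
    refine .inr ⟨a, b, c, g₀, g₁, g₂, g₃, h₀, h₁, h₂, h₃, h₄, fun y z hyz =>
      (leadingCoeff_nonneg_of_quadratic_nonneg fun x => hq x y z).lt_of_ne' (hf y z hyz),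
      fun x y z => ?_⟩
    rw [h]; ring

theorem linearIndependent_triple_of_ne_zero {x y z : ℝ} (hz : z ≠ 0) :
    LinearIndependent ℝ ![![1, 0, 0], ![0, 1, 0], ![x, y, z]] := by
  rw [Fintype.linearIndependent_iff]
  intro g hg
  simp only [Fin.sum_univ_three] at hg
  have h0 := congrFun hg 0
  have h1 := congrFun hg 1
  have h2 := congrFun hg 2
  simp at h0 h1 h2
  have h2' := h2.resolve_right hz
  simp only [h2', zero_mul, add_zero] at h0 h1
  intro i
  fin_cases i <;> assumption

theorem IsNonnegQuartic.dominatesSquare_of_three_zeros_coords {F : (Fin 3 → ℝ) → ℝ}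
    (hF : IsNonnegQuartic F) (h₁ : F ![1, 0, 0] = 0) (h₂ : F ![0, 1, 0] = 0)
    (h₃ : F ![0, 0, 1] = 0) : DominatesSquare F := by
  rcases hF.dominatesSquare_or_exists_coeffs h₁ with h |
    ⟨a, b, c, g₀, g₁, g₂, g₃, k₀, k₁, m, k₃, k₄, hf, h⟩
  · exact h
  have hnn (x y z : ℝ) := h x y z ▸ hF.nonneg ![x, y, z]
  obtain rfl : k₀ = 0 := by simpa [h₂] using (h 0 1 0).symm
  obtain rfl : k₄ = 0 := by simpa [h₃] using (h 0 0 1).symm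
  obtain rfl : k₁ = 0 := eq_zero_of_cubic_nonneg (a := m) (b := k₃) (c := 0) fun y => by
    linarith [hnn 0 y 1]
  obtain rfl : k₃ = 0 := eq_zero_of_cubic_nonneg (a := m) (b := 0) (c := 0) fun z => by
    linarith [hnn 0 1 z]
  have hd (y z : ℝ) := sq_le_of_quadratic_nonneg fun x => hnn x y z
  obtain rfl : g₀ = 0 := by
    have := hd 1 0
    exact pow_eq_zero_iff two_ne_zero |>.1 (le_antisymm (by linarith) (sq_nonneg _))
  obtain rfl : g₃ = 0 := by
    have := hd 0 1
    exact pow_eq_zero_iff two_ne_zero |>.1 (le_antisymm (by linarith) (sq_nonneg _))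
  have hm : 0 ≤ m := by linarith [hnn 0 1 1]
  rcases hm.eq_or_lt with rfl | hm
  · have hli : LinearIndependent ℝ ![![0, 1, 0], ![(0 : ℝ), 0, 1]] := by
      rw [LinearIndependent.pair_iff]
      intro s t hst
      have h1 := congrFun hst 1
      have h2 := congrFun hst 2
      simp at h1 h2
      exact ⟨h1, h2⟩
    refine hF.dominatesSquare_of_line hli fun s => ?_
    rw [smul_add_vec, h, h]
    ring
  · have hr : 0 < √m := Real.sqrt_pos.2 hm
    have hr2 : √m ^ 2 = m := Real.sq_sqrt hm.le
    -- The zeros reduce `h` to `m y² z²` and make `g` divisible by `y z`; this completes the square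
    -- in `y z`.
    refine .of_coeffs ![0, g₁ / (2 * √m), g₂ / (2 * √m), 0, √m, 0] (fun h0 => ?_)
      fun x y z => ?_
    · exact hr.ne' (congrFun h0 4)
    · have hD (y z : ℝ) (hz : z ≠ 0) : 0 ≤ 4 * (a * y ^ 2 + b * y * z + c * z ^ 2) * m -
          (g₁ * y + g₂ * z) ^ 2 := by
        refine nonneg_of_forall_ne_zero (φ := fun y => 4 * (a * y ^ 2 + b * y * z + c * z ^ 2) * m -
          (g₁ * y + g₂ * z) ^ 2) (by fun_prop) (fun y hy => ?_) y
        have hyz : 0 < (y * z) ^ 2 := by positivity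
        refine (mul_nonneg_iff_of_pos_right hyz).1 ?_
        have := hd y z
        linarith
      have hD' := nonneg_of_forall_ne_zero (φ := fun z =>
        4 * (a * y ^ 2 + b * y * z + c * z ^ 2) * m - (g₁ * y + g₂ * z) ^ 2) (by fun_prop)
        (fun z hz => hD y z hz) z
      rw [h]
      simp only [Matrix.cons_val]
      generalize √m = r at *
      subst hr2
      have h4 : (0 * x ^ 2 + g₁ / (2 * r) * (x * y) + g₂ / (2 * r) * (x * z) + 0 * y ^ 2 +
          r * (y * z) + 0 * z ^ 2) ^ 2 = (g₁ * y + g₂ * z) ^ 2 / (4 * r ^ 2) * x ^ 2 +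
          (g₁ * y ^ 2 * z + g₂ * y * z ^ 2) * x + r ^ 2 * y ^ 2 * z ^ 2 := by
        field_simp; ring
      have h5 : (g₁ * y + g₂ * z) ^ 2 / (4 * r ^ 2) ≤ a * y ^ 2 + b * y * z + c * z ^ 2 := by
        rw [div_le_iff₀ (by positivity)]; linarith
      rw [h4]
      linarith [mul_le_mul_of_nonneg_right h5 (sq_nonneg x)]

theorem IsNonnegQuartic.dominatesSquare_of_three_zeros {F : (Fin 3 → ℝ) → ℝ}
    (hF : IsNonnegQuartic F) {u v w : Fin 3 → ℝ} (huvw : LinearIndependent ℝ ![u, v, w])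
    (hu : F u = 0) (hv : F v = 0) (hw : F w = 0) : DominatesSquare F := by
  obtain ⟨T, hT⟩ := exists_linearEquiv_of_triple huvw
  exact .of_comp T ((hF.comp T).dominatesSquare_of_three_zeros_coords
    (by simpa [hT] using hu) (by simpa [hT] using hv) (by simpa [hT] using hw))

/-- Homogeneity of the minimum `(4 f h - g²) / (4 f)`, including `t = 0`, where division by zero
gives `0` and `k ≠ 0` is needed. -/
theorem div_eq_pow_mul_div {k : ℕ} (hk : k ≠ 0) {t n d n' d' : ℝ} (hn : n' = t ^ 2 * (t ^ k * n))
    (hd : d' = t ^ 2 * d) : n' / d' = t ^ k * (n / d) := by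
  rcases eq_or_ne t 0 with rfl | ht
  · simp [hd, hk]
  · rw [hn, hd, mul_div_mul_left _ _ (pow_ne_zero 2 ht), mul_div_assoc]

/-- A quadratic polynomial with positive leading coefficient is bounded below by its minimum. -/
theorem div_le_quadratic {f : ℝ} (hf : 0 < f) (g h x : ℝ) :
    (4 * f * h - g ^ 2) / (4 * f) ≤ f * x ^ 2 + g * x + h := by
  rw [div_le_iff₀ (by positivity)]
  nlinarith [sq_nonneg (2 * f * x + g)]

theorem IsNonnegQuartic.dominatesSquare_of_two_zeros_coords {F : (Fin 3 → ℝ) → ℝ}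
    (hF : IsNonnegQuartic F) (h₁ : F ![1, 0, 0] = 0) (h₂ : F ![0, 1, 0] = 0) :
    DominatesSquare F := by
  rcases hF.dominatesSquare_or_exists_coeffs h₁ with h |
    ⟨a, b, c, g₀, g₁, g₂, g₃, k₀, k₁, k₂, k₃, k₄, hf, h⟩
  · exact h
  have hnn (x y z : ℝ) := h x y z ▸ hF.nonneg ![x, y, z]
  obtain rfl : k₀ = 0 := by simpa [h₂] using (h 0 1 0).symm
  obtain rfl : k₁ = 0 := eq_zero_of_cubic_nonneg (a := k₂) (b := k₃) (c := k₄) fun y => by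
    linarith [hnn 0 y 1]
  have hd (y z : ℝ) := sq_le_of_quadratic_nonneg fun x => hnn x y z
  obtain rfl : g₀ = 0 := by
    have := hd 1 0
    exact pow_eq_zero_iff two_ne_zero |>.1 (le_antisymm (by linarith) (sq_nonneg _))
  -- The second zero makes `g` divisible by `z` and `h` by `z²`; this is the discriminant in `x`
  -- with `z²` removed.
  have hD (y z : ℝ) : 0 ≤ 4 * (a * y ^ 2 + b * y * z + c * z ^ 2) *
      (k₂ * y ^ 2 + k₃ * y * z + k₄ * z ^ 2) - (g₁ * y ^ 2 + g₂ * y * z + g₃ * z ^ 2) ^ 2 := by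
    refine nonneg_of_forall_ne_zero (φ := fun z => 4 * (a * y ^ 2 + b * y * z + c * z ^ 2) *
      (k₂ * y ^ 2 + k₃ * y * z + k₄ * z ^ 2) - (g₁ * y ^ 2 + g₂ * y * z + g₃ * z ^ 2) ^ 2)
      (by fun_prop) (fun z hz => ?_) z
    have hz2 : 0 < z ^ 2 := by positivity
    refine (mul_nonneg_iff_of_pos_right hz2).1 ?_
    have := hd y z
    linarith
  by_cases hex : ∃ y z, (y, z) ≠ (0 : ℝ × ℝ) ∧ 4 * (a * y ^ 2 + b * y * z + c * z ^ 2) *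
      (k₂ * y ^ 2 + k₃ * y * z + k₄ * z ^ 2) - (g₁ * y ^ 2 + g₂ * y * z + g₃ * z ^ 2) ^ 2 = 0
  · obtain ⟨y, z, hyz, h0⟩ := hex
    by_cases hz : z = 0
    · subst hz
      have hy : y ≠ 0 := fun hy => hyz (by simp [hy])
      have hac : 4 * a * k₂ = g₁ ^ 2 := by
        have hy4 : y ^ 4 ≠ 0 := pow_ne_zero _ hy
        apply mul_right_cancel₀ hy4
        linarith
      have ha : 0 < a := by simpa using hf 1 0 (by simp)
      -- The coefficient of `y²` in `F` is `a x² + g₁ x z + k₂ z²`, degenerate by `hac`, with kernel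
      -- vector `(x, z) = (-g₁, 2 a)`. Along the line over it in direction `y`, `F` is linear and
      -- nonnegative, hence constant.
      have hli : LinearIndependent ℝ ![![0, 1, 0], ![-g₁, 0, 2 * a]] := by
        rw [LinearIndependent.pair_iff]
        intro s t hst
        have h1 := congrFun hst 1
        have h2 := congrFun hst 2
        simp [ha.ne'] at h1 h2
        exact ⟨h1, h2⟩
      have hquad : a * g₁ ^ 2 - g₁ * (g₁ * (2 * a)) + k₂ * (2 * a) ^ 2 = 0 := by
        linear_combination a * hac
      have hlin := eq_zero_of_linear_nonneg (a := b * (2 * a) * g₁ ^ 2 - g₂ * (2 * a) ^ 2 * g₁ +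
          k₃ * (2 * a) ^ 3) (b := F ![-g₁, 0, 2 * a]) fun s => by
        have := hnn (-g₁) s (2 * a)
        rw [h]
        linear_combination this + s ^ 2 * hquad
      refine hF.dominatesSquare_of_line hli fun s => ?_
      rw [smul_add_vec, h, h]
      linear_combination s ^ 2 * hquad + s * hlin
    · have hfp := hf y z hyz
      -- The vertex `x = -g / (2 f)` of the parabola, with minimum zero, is a third zero,
      -- independent because `z ≠ 0`.
      refine hF.dominatesSquare_of_three_zeros (linearIndependent_triple_of_ne_zero
        (x := -(g₁ * y ^ 2 + g₂ * y * z + g₃ * z ^ 2) * z /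
          (2 * (a * y ^ 2 + b * y * z + c * z ^ 2))) (y := y) hz) h₁ h₂ ?_
      rw [h]
      generalize a * y ^ 2 + b * y * z + c * z ^ 2 = f at *
      field_simp
      linear_combination z ^ 2 * h0
  · push Not at hex
    obtain ⟨ε, hε, hle⟩ := exists_mul_pow_le (k := 2) (φ := fun v =>
      (4 * (a * v.1 ^ 2 + b * v.1 * v.2 + c * v.2 ^ 2) *
      (k₂ * v.1 ^ 2 + k₃ * v.1 * v.2 + k₄ * v.2 ^ 2) -
      (g₁ * v.1 ^ 2 + g₂ * v.1 * v.2 + g₃ * v.2 ^ 2) ^ 2) /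
      (4 * (a * v.1 ^ 2 + b * v.1 * v.2 + c * v.2 ^ 2)))
      (ContinuousOn.div (by fun_prop) (by fun_prop) fun v hv =>
        (mul_pos four_pos (hf v.1 v.2 hv)).ne')
      (fun t y z => div_eq_pow_mul_div two_ne_zero (by ring) (by ring))
      (fun v hv => div_pos ((hD _ _).lt_of_ne' (hex v.1 v.2 hv))
        (mul_pos four_pos (hf v.1 v.2 hv)))
    refine .of_pow_le hε fun x y z => ?_
    by_cases hyz : (y, z) = (0 : ℝ × ℝ)
    · simp only [Prod.mk_eq_zero] at hyz
      simpa [hyz] using hF.nonneg ![x, 0, 0]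
    · have h3 := hle y z hyz
      rw [sq_abs] at h3
      have h4 := div_le_quadratic (hf y z hyz) ((g₁ * y ^ 2 + g₂ * y * z + g₃ * z ^ 2) * z)
        ((k₂ * y ^ 2 + k₃ * y * z + k₄ * z ^ 2) * z ^ 2) x
      calc ε * z ^ 4 = (ε * z ^ 2) * z ^ 2 := by ring
        _ ≤ _ := mul_le_mul_of_nonneg_right h3 (sq_nonneg z)
        _ ≤ _ := le_of_eq_of_le (by ring) h4
        _ = _ := by rw [h]; ring

theorem IsNonnegQuartic.dominatesSquare_of_two_zeros {F : (Fin 3 → ℝ) → ℝ}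
    (hF : IsNonnegQuartic F) {u v : Fin 3 → ℝ} (huv : LinearIndependent ℝ ![u, v])
    (hu : F u = 0) (hv : F v = 0) : DominatesSquare F := by
  obtain ⟨T, rfl, rfl⟩ := exists_linearEquiv_of_pair huv
  exact .of_comp T ((hF.comp T).dominatesSquare_of_two_zeros_coords hu hv)

theorem IsNonnegQuartic.dominatesSquare_of_zero_coords {F : (Fin 3 → ℝ) → ℝ}
    (hF : IsNonnegQuartic F) (h₁ : F ![1, 0, 0] = 0) : DominatesSquare F := by
  rcases hF.dominatesSquare_or_exists_coeffs h₁ with h |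
    ⟨a, b, c, g₀, g₁, g₂, g₃, k₀, k₁, k₂, k₃, k₄, hf, h⟩
  · exact h
  have hnn (x y z : ℝ) := h x y z ▸ hF.nonneg ![x, y, z]
  have hd (y z : ℝ) := sq_le_of_quadratic_nonneg fun x => hnn x y z
  by_cases hex : ∃ y z, (y, z) ≠ (0 : ℝ × ℝ) ∧
      (g₀ * y ^ 3 + g₁ * y ^ 2 * z + g₂ * y * z ^ 2 + g₃ * z ^ 3) ^ 2 =
      4 * (a * y ^ 2 + b * y * z + c * z ^ 2) *
      (k₀ * y ^ 4 + k₁ * y ^ 3 * z + k₂ * y ^ 2 * z ^ 2 + k₃ * y * z ^ 3 + k₄ * z ^ 4)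
  · obtain ⟨y, z, hyz, h0⟩ := hex
    have hfp := hf y z hyz
    -- A vanishing discriminant makes the vertex `x = -g / (2 f)` a second zero.
    refine hF.dominatesSquare_of_two_zeros (linearIndependent_pair_of_ne_zero hyz
      (-(g₀ * y ^ 3 + g₁ * y ^ 2 * z + g₂ * y * z ^ 2 + g₃ * z ^ 3) /
        (2 * (a * y ^ 2 + b * y * z + c * z ^ 2)))) h₁ ?_
    rw [h]
    generalize a * y ^ 2 + b * y * z + c * z ^ 2 = f at *
    field_simp
    linear_combination -h0
  · push Not at hex
    obtain ⟨ε, hε, hle⟩ := exists_mul_pow_le (k := 4) (φ := fun v =>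
      (4 * (a * v.1 ^ 2 + b * v.1 * v.2 + c * v.2 ^ 2) *
      (k₀ * v.1 ^ 4 + k₁ * v.1 ^ 3 * v.2 + k₂ * v.1 ^ 2 * v.2 ^ 2 + k₃ * v.1 * v.2 ^ 3 +
        k₄ * v.2 ^ 4) -
      (g₀ * v.1 ^ 3 + g₁ * v.1 ^ 2 * v.2 + g₂ * v.1 * v.2 ^ 2 + g₃ * v.2 ^ 3) ^ 2) /
      (4 * (a * v.1 ^ 2 + b * v.1 * v.2 + c * v.2 ^ 2)))
      (ContinuousOn.div (by fun_prop) (by fun_prop) fun v hv =>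
        (mul_pos four_pos (hf v.1 v.2 hv)).ne')
      (fun t y z => div_eq_pow_mul_div four_ne_zero (by ring) (by ring))
      (fun v hv => div_pos (sub_pos.2 ((hd _ _).lt_of_ne (hex v.1 v.2 hv)))
        (mul_pos four_pos (hf v.1 v.2 hv)))
    refine .of_pow_le hε fun x y z => ?_
    by_cases hyz : (y, z) = (0 : ℝ × ℝ)
    · simp only [Prod.mk_eq_zero] at hyz
      simpa [hyz] using hF.nonneg ![x, 0, 0]
    · have h3 := hle y z hyz
      rw [Even.pow_abs (by decide)] at h3
      rw [h]
      exact h3.trans (div_le_quadratic (hf y z hyz) _ _ x)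

/-- Every nonzero nonnegative ternary quartic dominates the square of a nonzero quadratic form. -/
theorem IsNonnegQuartic.dominatesSquare {F : (Fin 3 → ℝ) → ℝ} (hF : IsNonnegQuartic F) :
    DominatesSquare F := by
  by_cases hz : ∃ u, u ≠ 0 ∧ F u = 0
  · obtain ⟨u, hu, h0⟩ := hz
    obtain ⟨T, rfl⟩ := exists_linearEquiv_of_ne_zero hu
    exact .of_comp T ((hF.comp T).dominatesSquare_of_zero_coords h0)
  · push Not at hz
    obtain ⟨ε, hε, hle⟩ := exists_le_of_homogeneous hF.isForm.continuous.continuousOn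
      hF.isForm.smul fun v hv => (hF.nonneg v).lt_of_ne' (hz v hv)
    refine .of_pow_le hε fun x y z => ?_
    by_cases hv : ![x, y, z] = 0
    · have h2 := congrFun hv 2
      simp at h2
      simpa [h2] using hF.nonneg ![x, y, 0]
    · refine le_trans ?_ (hle _ hv)
      have h2 : |z| ≤ ‖![x, y, z]‖ := norm_le_pi_norm ![x, y, z] 2
      rw [← Even.pow_abs (by decide : Even 4) z]
      gcongr

/-! ### Gram matrices and the trace maximization -/

open Matrix

theorem eq_zero_of_binary_quartic_eq_zero {a b c d e : ℝ}
    (h : ∀ x y : ℝ, a * x ^ 4 + b * x ^ 3 * y + c * x ^ 2 * y ^ 2 + d * x * y ^ 3 + e * y ^ 4 = 0) :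
    a = 0 ∧ b = 0 ∧ c = 0 ∧ d = 0 ∧ e = 0 := by
  have h1 := h 1 0
  have h2 := h 0 1
  have h3 := h 1 1
  have h4 := h 1 (-1)
  have h5 := h 1 2
  refine ⟨?_, ?_, ?_, ?_, ?_⟩ <;> linarith

theorem gram_apply (G : Matrix (Fin 6) (Fin 6) ℝ) (hG : G.IsHermitian) (x y z : ℝ) :
    monomials ![x, y, z] ⬝ᵥ G *ᵥ monomials ![x, y, z] =
      G 0 0 * x ^ 4 + 2 * G 0 1 * x ^ 3 * y + 2 * G 0 2 * x ^ 3 * z +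
      (G 1 1 + 2 * G 0 3) * x ^ 2 * y ^ 2 + (2 * G 0 4 + 2 * G 1 2) * x ^ 2 * y * z +
      (G 2 2 + 2 * G 0 5) * x ^ 2 * z ^ 2 + 2 * G 1 3 * x * y ^ 3 +
      (2 * G 1 4 + 2 * G 2 3) * x * y ^ 2 * z + (2 * G 2 4 + 2 * G 1 5) * x * y * z ^ 2 +
      2 * G 2 5 * x * z ^ 3 + G 3 3 * y ^ 4 + 2 * G 3 4 * y ^ 3 * z +
      (G 4 4 + 2 * G 3 5) * y ^ 2 * z ^ 2 + 2 * G 4 5 * y * z ^ 3 + G 5 5 * z ^ 4 := by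
  have hs (i j : Fin 6) : G i j = G j i := by simpa using (hG.apply i j).symm
  simp only [monomials, dotProduct, mulVec, Fin.sum_univ_six, Matrix.cons_val]
  rw [hs 1 0, hs 2 0, hs 2 1, hs 3 0, hs 3 1, hs 3 2, hs 4 0, hs 4 1, hs 4 2, hs 4 3, hs 5 0,
    hs 5 1, hs 5 2, hs 5 3, hs 5 4]
  ring

theorem A₀_add_Wmat_isHermitian (p : MvPolynomial (Fin 3) ℝ) (w₁ w₂ w₃ w₄ w₅ w₆ : ℝ) :
    (A₀ p + Wmat w₁ w₂ w₃ w₄ w₅ w₆).IsHermitian := by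
  ext i j
  fin_cases i <;> fin_cases j <;> simp [A₀, Wmat]

/-- The Gram matrices of `p` are the symmetric matrices in `A₀ p + W`. -/
theorem mem_add_W_iff {p : MvPolynomial (Fin 3) ℝ} (hp : p.IsHomogeneous 4)
    {G : Matrix (Fin 6) (Fin 6) ℝ} (hG : G.IsHermitian) :
    G ∈ {A₀ p} + (W : Set (Matrix (Fin 6) (Fin 6) ℝ)) ↔
      ∀ v, monomials v ⬝ᵥ G *ᵥ monomials v = eval v p := by
  rw [Set.singleton_add, Set.mem_image]
  constructor
  · rintro ⟨_, ⟨w₁, w₂, w₃, w₄, w₅, w₆, rfl⟩, rfl⟩ v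
    rw [vec_eq v, gram_apply _ hG, eval_quartic hp]
    simp [A₀, Wmat]
    ring
  · intro h
    replace h (x y z : ℝ) := h ![x, y, z]
    simp only [gram_apply G hG, eval_quartic hp] at h
    -- Restriction to the three coordinate planes compares all coefficients except those of `x²yz`,
    -- `xy²z`, `xyz²`; sign changes separate these.
    obtain ⟨c1, c2, c3, c4, c5⟩ := eq_zero_of_binary_quartic_eq_zero
      (a := G 0 0 - pcoeff p 4 0 0) (b := 2 * G 0 1 - pcoeff p 3 1 0)
      (c := G 1 1 + 2 * G 0 3 - pcoeff p 2 2 0) (d := 2 * G 1 3 - pcoeff p 1 3 0)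
      (e := G 3 3 - pcoeff p 0 4 0) fun x y => by linarith [h x y 0]
    obtain ⟨-, c6, c7, c8, c9⟩ := eq_zero_of_binary_quartic_eq_zero
      (a := G 0 0 - pcoeff p 4 0 0) (b := 2 * G 0 2 - pcoeff p 3 0 1)
      (c := G 2 2 + 2 * G 0 5 - pcoeff p 2 0 2) (d := 2 * G 2 5 - pcoeff p 1 0 3)
      (e := G 5 5 - pcoeff p 0 0 4) fun x z => by linarith [h x 0 z]
    obtain ⟨-, c10, c11, c12, -⟩ := eq_zero_of_binary_quartic_eq_zero
      (a := G 3 3 - pcoeff p 0 4 0) (b := 2 * G 3 4 - pcoeff p 0 3 1)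
      (c := G 4 4 + 2 * G 3 5 - pcoeff p 0 2 2) (d := 2 * G 4 5 - pcoeff p 0 1 3)
      (e := G 5 5 - pcoeff p 0 0 4) fun y z => by linarith [h 0 y z]
    have e1 := h 1 1 1
    have e2 := h (-1) 1 1
    have e3 := h 1 (-1) 1
    have c13 : 2 * G 0 4 + 2 * G 1 2 - pcoeff p 2 1 1 = 0 := by linarith
    have c14 : 2 * G 1 4 + 2 * G 2 3 - pcoeff p 1 2 1 = 0 := by linarith
    have c15 : 2 * G 2 4 + 2 * G 1 5 - pcoeff p 1 1 2 = 0 := by linarith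
    clear e1 e2 e3 h
    -- Each parameter is read off an entry where it stands alone in `Wmat`, minus the entry of `A₀
    -- p` there.
    refine ⟨_, ⟨G 0 3, G 0 4 - pcoeff p 2 1 1 / 2, G 0 5, G 1 4 - pcoeff p 1 2 1 / 2, G 1 5, G 3 5,
      rfl⟩, ?_⟩
    have hA := A₀_add_Wmat_isHermitian p (G 0 3) (G 0 4 - pcoeff p 2 1 1 / 2) (G 0 5)
      (G 1 4 - pcoeff p 1 2 1 / 2) (G 1 5) (G 3 5)
    have key : ∀ i j, i ≤ j → (A₀ p + Wmat (G 0 3) (G 0 4 - pcoeff p 2 1 1 / 2) (G 0 5)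
      (G 1 4 - pcoeff p 1 2 1 / 2) (G 1 5) (G 3 5)) i j = G i j := by
      intro i j hij
      fin_cases i <;> fin_cases j <;> first
        | exact absurd hij (by decide)
        | simp [A₀, Wmat]; try linarith
    ext i j
    rcases le_total i j with hij | hij
    · exact key i j hij
    · exact (hA.apply i j).symm.trans ((congrArg star (key j i hij)).trans (hG.apply i j))

theorem isForm_gram (G : Matrix (Fin 6) (Fin 6) ℝ) :
    IsForm 4 fun v => monomials v ⬝ᵥ G *ᵥ monomials v := by
  refine ⟨∑ i, ∑ j, C (G i j) * (quadraticForm (Pi.single i 1) * quadraticForm (Pi.single j 1)),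
    IsHomogeneous.sum _ _ _ fun i _ => IsHomogeneous.sum _ _ _ fun j _ => ?_, fun v => ?_⟩
  · simpa using (isHomogeneous_C _ (G i j)).mul ((quadraticForm_isHomogeneous (Pi.single i 1)).mul
      (quadraticForm_isHomogeneous (Pi.single j 1)))
  · simp only [map_sum, map_mul, eval_C, eval_quadraticForm, single_one_dotProduct]
    simp only [dotProduct, mulVec, Finset.mul_sum]
    exact Finset.sum_congr rfl fun i _ => Finset.sum_congr rfl fun j _ => by ring

theorem gram_vecMulVec (c m : Fin 6 → ℝ) : m ⬝ᵥ vecMulVec c c *ᵥ m = (c ⬝ᵥ m) ^ 2 := by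
  rw [vecMulVec_mulVec, op_smul_eq_smul, dotProduct_smul, dotProduct_comm m c, smul_eq_mul, sq]

/-- Averaging over `(1, ±1, ±1)` kills odd monomials and leaves the trace plus `2 (G 0 3 + G 0 5 + G
3 5)`. Positivity on `(1, 0, 0, 1, 0, 1)` bounds that excess below by `-(G 0 0 + G 3 3 + G 5 5)`,
which the coordinate vectors control. -/
theorem trace_le_of_gram_le {F : (Fin 3 → ℝ) → ℝ} {G : Matrix (Fin 6) (Fin 6) ℝ}
    (hG : G.PosSemidef) (h : ∀ v, monomials v ⬝ᵥ G *ᵥ monomials v ≤ F v) :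
    G.trace ≤ F ![1, 0, 0] + F ![0, 1, 0] + F ![0, 0, 1] +
      (F ![1, 1, 1] + F ![1, 1, -1] + F ![1, -1, 1] + F ![1, -1, -1]) / 4 := by
  have h1 := h ![1, 0, 0]
  have h2 := h ![0, 1, 0]
  have h3 := h ![0, 0, 1]
  have h4 := h ![1, 1, 1]
  have h5 := h ![1, 1, -1]
  have h6 := h ![1, -1, 1]
  have h7 := h ![1, -1, -1]
  simp only [gram_apply G hG.1] at h1 h2 h3 h4 h5 h6 h7
  have h8 := hG.dotProduct_mulVec_nonneg ![1, 0, 0, 1, 0, 1]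
  have hs (i j : Fin 6) : G i j = G j i := by simpa using (hG.1.apply i j).symm
  simp [dotProduct, mulVec, Fin.sum_univ_six] at h8
  rw [hs 3 0, hs 5 0, hs 5 3] at h8
  simp only [trace, diag, Fin.sum_univ_six]
  linarith

theorem abs_apply_le_trace {G : Matrix (Fin 6) (Fin 6) ℝ} (hG : G.PosSemidef) (i j : Fin 6) :
    |G i j| ≤ G.trace := by
  have hd (i : Fin 6) : G i i ≤ G.trace :=
    Finset.single_le_sum (f := fun i => G i i) (fun i _ => hG.diag_nonneg) (Finset.mem_univ i)
  have hs : G i j = G j i := by simpa using (hG.1.apply i j).symm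
  have h1 := hG.dotProduct_mulVec_nonneg (Pi.single i 1 + Pi.single j 1)
  have h2 := hG.dotProduct_mulVec_nonneg (Pi.single i 1 - Pi.single j 1)
  simp [mulVec_add, mulVec_sub, add_dotProduct, sub_dotProduct, dotProduct_add, dotProduct_sub] at h1 h2
  have := hd i
  have := hd j
  rw [abs_le]
  constructor <;> linarith

theorem isCompact_setOf_gram_le (F : (Fin 3 → ℝ) → ℝ) :
    IsCompact {G : Matrix (Fin 6) (Fin 6) ℝ | G.PosSemidef ∧
      ∀ v, monomials v ⬝ᵥ G *ᵥ monomials v ≤ F v} := by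
  set C := F ![1, 0, 0] + F ![0, 1, 0] + F ![0, 0, 1] +
      (F ![1, 1, 1] + F ![1, 1, -1] + F ![1, -1, 1] + F ![1, -1, -1]) / 4
  have hcpt : IsCompact (Set.univ.pi fun _ : Fin 6 => Set.univ.pi fun _ : Fin 6 => Set.Icc (-C) C) :=
    isCompact_univ_pi fun _ => isCompact_univ_pi fun _ => isCompact_Icc
  refine IsCompact.of_isClosed_subset hcpt ?_ ?_
  · simp only [posSemidef_iff_dotProduct_mulVec, IsHermitian, Set.ofPred_and, Set.ofPred_forall]
    refine ((isClosed_eq (by fun_prop) (by fun_prop)).inter (isClosed_iInter fun x =>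
      isClosed_le (by fun_prop) (by fun_prop))).inter (isClosed_iInter fun v =>
      isClosed_le (by fun_prop) (by fun_prop))
  · rintro G ⟨hG, h⟩ i - j -
    exact abs_le.1 ((abs_apply_le_trace hG i j).trans (trace_le_of_gram_le hG h))

/-- A nonnegative ternary quartic is represented by a positive semidefinite Gram matrix. -/
theorem exists_posSemidef_gram {F : (Fin 3 → ℝ) → ℝ} (hF : IsForm 4 F) (h0 : ∀ v, 0 ≤ F v) :
    ∃ G : Matrix (Fin 6) (Fin 6) ℝ, G.PosSemidef ∧
      ∀ v, monomials v ⬝ᵥ G *ᵥ monomials v = F v := by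
  obtain ⟨G, ⟨hG, hle⟩, hmax⟩ := (isCompact_setOf_gram_le F).exists_isMaxOn
    ⟨0, PosSemidef.zero, by simpa using h0⟩ (f := trace) (by fun_prop)
  refine ⟨G, hG, ?_⟩
  by_contra! hne
  obtain ⟨v, hv⟩ := hne
  obtain ⟨p, hp, hpF⟩ := hF
  obtain ⟨r, hr, hrG⟩ := isForm_gram G
  have hD : IsNonnegQuartic fun v => F v - monomials v ⬝ᵥ G *ᵥ monomials v :=
    ⟨⟨p - r, hp.sub hr, fun v => by simp only [map_sub, hpF, ← hrG]⟩, fun v => sub_nonneg.2 (hle v),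
      v, sub_ne_zero.2 hv.symm⟩
  obtain ⟨q, hq, ⟨u, hu⟩, hqle⟩ := hD.dominatesSquare
  obtain ⟨c, hc⟩ := hq.exists_dotProduct
  have hc0 : c ≠ 0 := by
    rintro rfl
    simp [hc] at hu
  -- The dominated square fits into the residual, so the enlarged matrix is still feasible; its
  -- trace grows by `c ⬝ᵥ c > 0`.
  have hmem : G + vecMulVec c c ∈ {G : Matrix (Fin 6) (Fin 6) ℝ | G.PosSemidef ∧
      ∀ v, monomials v ⬝ᵥ G *ᵥ monomials v ≤ F v} := by
    refine ⟨hG.add (by simpa using posSemidef_vecMulVec_self_star c), fun v => ?_⟩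
    rw [add_mulVec, dotProduct_add, gram_vecMulVec, ← hc]
    linarith [hqle v]
  have h1 : (G + vecMulVec c c).trace ≤ G.trace := hmax hmem
  rw [trace_add, trace_vecMulVec] at h1
  have h2 : 0 < c ⬝ᵥ c := by
    have := dotProduct_star_self_pos_iff.2 hc0
    simpa using this
  linarith

theorem isSumOfSquares_iff {p : MvPolynomial (Fin 3) ℝ} (hp : p.IsHomogeneous 4) :
    IsSumOfSquaresOfQuadraticForms p ↔
      (({A₀ p} + (W : Set (Matrix (Fin 6) (Fin 6) ℝ))) ∩ PSD 6).Nonempty := by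
  constructor
  · rintro ⟨k, q, hq, hsum⟩
    have hq' (i : Fin k) : ∃ c : Fin 6 → ℝ, ∀ v, eval v (q i) = c ⬝ᵥ monomials v :=
      IsForm.exists_dotProduct ⟨q i, hq i, fun v => rfl⟩
    choose c hc using hq'
    have hG : (∑ i, vecMulVec (c i) (c i)).PosSemidef :=
      posSemidef_sum _ fun i _ => by simpa using posSemidef_vecMulVec_self_star (c i)
    refine ⟨_, (mem_add_W_iff hp hG.1).2 fun v => ?_, hG⟩
    rw [sum_mulVec, dotProduct_sum, hsum]
    simp [gram_vecMulVec, hc]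
  · rintro ⟨G, hmem, hG⟩
    have hG' : G.PosSemidef := hG
    have h := (mem_add_W_iff hp hG'.1).1 hmem
    obtain ⟨k, c, rfl⟩ := posSemidef_iff_eq_sum_vecMulVec.1 hG'
    refine ⟨k, fun i => quadraticForm (c i), fun i => quadraticForm_isHomogeneous _, ?_⟩
    refine MvPolynomial.funext fun v => ?_
    rw [← h v, sum_mulVec, dotProduct_sum]
    simp [gram_vecMulVec, eval_quadraticForm]

end TernaryQuartic

theorem mainTheorem2 (p : MvPolynomial (Fin 3) ℝ) (hp : p.IsHomogeneous 4) :
    (TernaryQuartic.IsSumOfSquaresOfQuadraticForms p ↔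
      (({TernaryQuartic.A₀ p} + (TernaryQuartic.W : Set (Matrix (Fin 6) (Fin 6) ℝ))) ∩
        TernaryQuartic.PSD 6).Nonempty) ∧
    ((∀ v : Fin 3 → ℝ, 0 ≤ MvPolynomial.eval v p) →
      TernaryQuartic.IsSumOfSquaresOfQuadraticForms p ∧
      (({TernaryQuartic.A₀ p} + (TernaryQuartic.W : Set (Matrix (Fin 6) (Fin 6) ℝ))) ∩
        TernaryQuartic.PSD 6).Nonempty) := by
  have hiff := TernaryQuartic.isSumOfSquares_iff hp
  refine ⟨hiff, fun h => ?_⟩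
  obtain ⟨G, hG, hGp⟩ := TernaryQuartic.exists_posSemidef_gram ⟨p, hp, fun _ => rfl⟩ h
  have hne : (({TernaryQuartic.A₀ p} + (TernaryQuartic.W : Set (Matrix (Fin 6) (Fin 6) ℝ))) ∩
      TernaryQuartic.PSD 6).Nonempty := ⟨G, (TernaryQuartic.mem_add_W_iff hp hG.1).2 hGp, hG⟩
  exact ⟨hiff.2 hne, hne⟩
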